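/- Let $R$ be a commutative ring, $n$ a natural number, and $A$ a commutative $R$-algebra of rank $n$, i.e. one for which the set of all $r\in R$ such that $A_r$ is free of rank $n$ over $R_r$ generates the unit ideal of $R$. For such an algebra, the norm $N_{A/R}(a)$ of $a\in A$ is the unique element of $R$ with $(aa_1)\wedge\dots\wedge(aa_n)=N_{A/R}(a)\,(a_1\wedge\dots\wedge a_n)$ in $\bigwedge^n_R A$ for all $a_1,\dots,a_n\in A$. For a subgroup $G\le S_n$ let $(A^{\otimes n})^{G}$ be the subalgebra of elements of $A^{\otimes n}=A\otimes_R\cdots\otimes_R A$ fixed by $G$, which permutes the tensor factors. The Ferrand homomorphism $\Phi_{A/R}\colon (A^{\otimes n})^{S_n}\to R$ is the canonical $R$-algebra homomorphism that sends $a\otimes\dots\otimes a$ to $N_{A/R}(a)$ and commutes with base change; explicitly, $\Phi_{A/R}(x)$ is the unique scalar through which multiplication by $x$ on $A^{\otimes n}$ acts on the quotient $\bigwedge^n_R A$. A $G$-closure datum for $A$ over $R$ is an $R$-algebra homomorphism $(A^{\otimes n})^{G}\to R$ whose restriction to $(A^{\otimes n})^{S_n}$ is $\Phi_{A/R}$.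 A homomorphism $f\colon A\to B$ of $R$-algebras of rank $n$ is universally norm-preserving if for every commutative $R$-algebra $S$ and every $x\in S\otimes_R A$ one has $N_{S\otimes_R A/S}(x)=N_{S\otimes_R B/S}((\mathrm{id}_S\otimes f)(x))$. Proposition. Let $f_1,\dots,f_n\colon A\to R$ be $R$-algebra homomorphisms, and let $$\bigotimes_{i=1}^n f_i\colon A^{\otimes n}\to R,\quad a_1\otimes\dots\otimes a_n\mapsto f_1(a_1)\cdots f_n(a_n),\qquad \prod_{i=1}^n f_i\colon A\to R^n,\quad a\mapsto(f_1(a),\dots,f_n(a)).$$ Then $\bigotimes_i f_i$ is a $1$-closure datum for $A$ over $R$ (that is, a $G$-closure datum for the trivial group $G=1\le S_n$) if and only if $\prod_i f_i$ is a universally norm-preserving homomorphism from $A$ to $R^n$. -/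

import Mathlib

open scoped TensorProduct

universe u v w

namespace ClosureDatum

section LocallyFree

/-- An `R`-module `M` is locally free of rank `n` if the set of all `r : R` such that the
localization `M_r` is free of rank `n` over `R_r` generates the unit ideal. -/
class IsLocallyFreeOfRank (R : Type u) [CommRing R] (n : ℕ) (M : Type v)
    [AddCommGroup M] [Module R M] : Prop where
  span_eq_top : Ideal.span {r : R | Nonempty (Module.Basis (Fin n)
    (Localization.Away r) (LocalizedModule (Submonoid.powers r) M))} = ⊤

instance (R : Type u) [CommRing R] (n : ℕ) : IsLocallyFreeOfRank R n (Fin n → R) where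
  span_eq_top := (Ideal.eq_top_iff_one _).2 <| Ideal.subset_span
    ⟨(Pi.basisFun R (Fin n)).ofIsLocalizedModule _ (Submonoid.powers (1 : R))
      (LocalizedModule.mkLinearMap _ _)⟩

/-- Local freeness of rank `n` is stable under base change. -/
instance (R : Type u) [CommRing R] (n : ℕ) (M : Type v) [AddCommGroup M] [Module R M]
    [h : IsLocallyFreeOfRank R n M] (S : Type w) [CommRing S] [Algebra R S] :
    IsLocallyFreeOfRank S n (S ⊗[R] M) where
  span_eq_top := by
    have key : Ideal.map (algebraMap R S) (Ideal.span {r : R | Nonempty (Module.Basis (Fin n)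
        (Localization.Away r) (LocalizedModule (Submonoid.powers r) M))}) = ⊤ := by
      rw [h.span_eq_top, Ideal.map_top]
    rw [Ideal.map_span] at key
    refine top_le_iff.1 (key ▸ Ideal.span_mono ?_)
    rintro _ ⟨r, ⟨b⟩, rfl⟩
    let s := algebraMap R S r
    let Rr := Localization.Away r
    let Ss := Localization.Away s
    let f : M →ₗ[R] LocalizedModule (Submonoid.powers r) M := LocalizedModule.mkLinearMap _ _
    let g : (S ⊗[R] M) →ₗ[S] LocalizedModule (Submonoid.powers s) (S ⊗[R] M) :=
      LocalizedModule.mkLinearMap _ _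
    let : Algebra Rr Ss := (IsLocalization.Away.lift (S := Rr) r
      (g := algebraMap R Ss) (by
        rw [IsScalarTower.algebraMap_apply R S Ss]
        exact IsLocalization.Away.algebraMap_isUnit s)).toAlgebra
    have : IsScalarTower R Rr Ss := .of_algebraMap_eq fun x => by
      rw [RingHom.algebraMap_toAlgebra, IsLocalization.Away.lift_eq]
    have hf : IsBaseChange Rr f := IsLocalizedModule.isBaseChange (Submonoid.powers r) Rr f
    have hg : IsBaseChange Ss g := IsLocalizedModule.isBaseChange (Submonoid.powers s) Ss g
    exact ⟨((b.map hf.equiv.symm).baseChange Ss).map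
      (TensorProduct.AlgebraTensorModule.cancelBaseChange R Rr Ss Ss M ≪≫ₗ
        (TensorProduct.AlgebraTensorModule.cancelBaseChange R S Ss Ss M).symm ≪≫ₗ hg.equiv)⟩

end LocallyFree

section Wedge

variable {R : Type u} [CommRing R] (n : ℕ) {M : Type v} [AddCommGroup M] [Module R M]

/-- The determinant functional on the top exterior power of `M`, with values in a localization
over which `M` becomes free of rank `n`. -/
noncomputable def localDet (r : R) (b : Module.Basis (Fin n) (Localization.Away r)
    (LocalizedModule (Submonoid.powers r) M)) : (⋀[R]^n M) →ₗ[R] Localization.Away r :=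
  exteriorPower.alternatingMapLinearEquiv
    { (b.det.toMultilinearMap.restrictScalars R).compLinearMap
        fun _ : Fin n => LocalizedModule.mkLinearMap (Submonoid.powers r) M with
      map_eq_zero_of_eq' := fun _ _ _ hv hij =>
        b.det.map_eq_zero_of_eq _ (congrArg (LocalizedModule.mkLinearMap _ M) hv) hij }

theorem localDet_ιMulti (r : R) (b : Module.Basis (Fin n) (Localization.Away r)
    (LocalizedModule (Submonoid.powers r) M)) (v : Fin n → M) :
    localDet n r b (exteriorPower.ιMulti R n v) =
      b.det fun i => LocalizedModule.mkLinearMap (Submonoid.powers r) M (v i) := by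
  simp [localDet]
  rfl

theorem alternating_linearCombination {N : Type*} [AddCommGroup N] [Module R N]
    (g : M [⋀^Fin n]→ₗ[R] N) (a : Fin n → M) (c : Fin n → Fin n → R) :
    g (fun i => ∑ k, c i k • a k) = (Pi.basisFun R (Fin n)).det c • g a := by
  let L : (Fin n → R) →ₗ[R] M := Fintype.linearCombination R a
  have key : g.compLinearMap L =
      (LinearMap.toSpanSingleton R N (g a)).compAlternatingMap (Pi.basisFun R (Fin n)).det := by
    refine Module.Basis.ext_alternating (Pi.basisFun R (Fin n)) fun i h => ?_
    let σ : Equiv.Perm (Fin n) := Equiv.ofBijective i (Finite.injective_iff_bijective.1 h)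
    change (g.compLinearMap L) (Pi.basisFun R (Fin n) ∘ σ) =
      ((LinearMap.toSpanSingleton R N (g a)).compAlternatingMap (Pi.basisFun R (Fin n)).det)
        (Pi.basisFun R (Fin n) ∘ σ)
    rw [AlternatingMap.map_perm, AlternatingMap.map_perm]
    congr 1
    simp only [AlternatingMap.compLinearMap_apply, LinearMap.compAlternatingMap_apply,
      Module.Basis.det_self, LinearMap.toSpanSingleton_apply, one_smul]
    congr 1
    funext k
    simp [L]
  have := congrArg (fun G => G c) key
  simpa [L, Fintype.linearCombination_apply] using this

/-- A locally chosen generator of the exterior power. -/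
theorem exists_frame (r : R) (b : Module.Basis (Fin n) (Localization.Away r)
    (LocalizedModule (Submonoid.powers r) M)) :
    ∃ a : Fin n → M, (∃ j : ℕ, localDet n r b (exteriorPower.ιMulti R n a) =
        algebraMap R (Localization.Away r) (r ^ j)) ∧
      ∀ m : ⋀[R]^n M, ∃ (K : ℕ) (c : R), r ^ K • m = c • exteriorPower.ιMulti R n a := by
  let f : M →ₗ[R] LocalizedModule (Submonoid.powers r) M := LocalizedModule.mkLinearMap _ _
  obtain ⟨a, N, ha⟩ : ∃ (a : Fin n → M) (N : ℕ), ∀ k, f (a k) = r ^ N • b k := by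
    choose x hx using fun k => IsLocalizedModule.surj (Submonoid.powers r) f (b k)
    choose K hK using fun k => (x k).2.2
    refine ⟨fun k => r ^ (∑ l ∈ Finset.univ.erase k, K l) • (x k).1, ∑ l, K l, fun k => ?_⟩
    rw [map_smul, ← hx k, Submonoid.smul_def, ← hK k, smul_smul, ← pow_add,
      Finset.sum_erase_add _ _ (Finset.mem_univ k)]
  refine ⟨a, ⟨N * n, ?_⟩, ?_⟩
  · rw [localDet_ιMulti]
    have : (fun i => f (a i)) =
        fun i => (algebraMap R (Localization.Away r) (r ^ N)) • b i := by
      funext i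
      rw [ha, algebraMap_smul]
    change b.det (fun i => f (a i)) = _
    rw [this, AlternatingMap.map_smul_univ, Module.Basis.det_self]
    simp [pow_mul]
  · have hM (x : M) : ∃ (K : ℕ) (c : Fin n → R), r ^ K • x = ∑ k, c k • a k := by
      choose c hc using fun k => IsLocalizedModule.surj (Submonoid.powers r)
        (Algebra.linearMap R (Localization.Away r)) (b.repr (f x) k)
      choose K hK using fun k => (c k).2.2
      have h1 : f (r ^ (N + ∑ l, K l) • x) =
          f (∑ k, (r ^ (∑ l ∈ Finset.univ.erase k, K l) * (c k).1) • a k) := by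
        rw [map_smul, map_sum]
        conv_lhs => rw [← b.sum_repr (f x)]
        rw [Finset.smul_sum]
        refine Finset.sum_congr rfl fun k _ => ?_
        have := hc k
        rw [Submonoid.smul_def, ← hK k, Algebra.linearMap_apply] at this
        rw [map_smul, ha, mul_smul, ← algebraMap_smul (Localization.Away r) (c k).1, ← this,
          smul_assoc, smul_smul, ← pow_add, Finset.sum_erase_add _ _ (Finset.mem_univ k),
          smul_comm _ (r ^ N), smul_smul, ← pow_add, add_comm, smul_comm]
      obtain ⟨⟨_, L, rfl⟩, hL⟩ := IsLocalizedModule.exists_of_eq (S := Submonoid.powers r) h1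
      refine ⟨L + (N + ∑ l, K l),
        fun k => r ^ L * (r ^ (∑ l ∈ Finset.univ.erase k, K l) * (c k).1), ?_⟩
      simp only [Submonoid.smul_def] at hL
      rw [pow_add, mul_smul, hL, Finset.smul_sum]
      simp only [mul_smul]
    intro m
    have hm : m ∈ Submodule.span R (Set.range (exteriorPower.ιMulti R n (M := M))) := by
      rw [exteriorPower.ιMulti_span]; trivial
    induction hm using Submodule.span_induction with
    | mem _ h =>
      obtain ⟨v, rfl⟩ := h
      choose K c hc using fun i => hM (v i)
      refine ⟨∑ i, K i, (Pi.basisFun R (Fin n)).det c, ?_⟩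
      rw [← alternating_linearCombination, ← Finset.prod_pow_eq_pow_sum,
        ← AlternatingMap.map_smul_univ]
      simp only [hc]
    | zero => exact ⟨0, 0, by simp⟩
    | add x y _ _ hx hy =>
      obtain ⟨K, c, h⟩ := hx
      obtain ⟨K', c', h'⟩ := hy
      refine ⟨K + K', r ^ K' * c + r ^ K * c', ?_⟩
      rw [smul_add, add_smul, mul_smul, mul_smul, ← h, ← h', smul_smul, smul_smul]
      ring_nf
    | smul t x _ hx =>
      obtain ⟨K, c, h⟩ := hx
      exact ⟨K, t * c, by rw [smul_comm, h, mul_smul]⟩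

theorem isLocalizedModule_localDet (r : R) (b : Module.Basis (Fin n) (Localization.Away r)
    (LocalizedModule (Submonoid.powers r) M)) :
    IsLocalizedModule (Submonoid.powers r) (localDet n r b) := by
  obtain ⟨a, ⟨j, hj⟩, ha⟩ := exists_frame n r b
  refine ⟨?_, ?_, ?_⟩
  · exact IsLocalizedModule.map_units (S := Submonoid.powers r)
      (Algebra.linearMap R (Localization.Away r))
  · intro y
    obtain ⟨⟨x, s, K, rfl⟩, hs⟩ := IsLocalizedModule.surj (Submonoid.powers r)
      (Algebra.linearMap R (Localization.Away r)) y
    refine ⟨⟨x • exteriorPower.ιMulti R n a, ⟨r ^ (K + j), K + j, rfl⟩⟩, ?_⟩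
    simp only [Submonoid.smul_def, Algebra.linearMap_apply] at hs ⊢
    rw [map_smul, hj, ← algebraMap_smul (Localization.Away r) x, ← hs, add_comm, pow_add,
      mul_smul, Algebra.smul_def (r ^ j), smul_eq_mul, mul_comm]
  · intro x y hxy
    obtain ⟨K, c, hc⟩ := ha (x - y)
    have h0 : algebraMap R (Localization.Away r) (c * r ^ j) = algebraMap R _ 0 := by
      have := congrArg (localDet n r b) hc
      rw [map_smul, map_smul, map_sub, hxy, sub_self, smul_zero, hj, Algebra.smul_def,
        ← map_mul] at this
      rw [← this, map_zero]
    obtain ⟨⟨_, L, rfl⟩, hL⟩ := IsLocalization.exists_of_eq (M := Submonoid.powers r) h0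
    refine ⟨⟨r ^ (L + j + K), L + j + K, rfl⟩, ?_⟩
    simp only [Submonoid.smul_def] at hL ⊢
    rw [← sub_eq_zero, ← smul_sub, pow_add, mul_smul, hc, smul_smul, pow_add, mul_assoc,
      mul_comm (r ^ j), hL, mul_zero, zero_smul]

/-- The only endomorphisms of the top exterior power of a module that is locally free of rank `n`
are the scalars. -/
theorem bijective_algebraMap_end [h : IsLocallyFreeOfRank R n M] :
    Function.Bijective (Algebra.linearMap R (Module.End R (⋀[R]^n M))) := by
  let s := {r : R | Nonempty (Module.Basis (Fin n)
    (Localization.Away r) (LocalizedModule (Submonoid.powers r) M))}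
  let b (r : s) := r.2.some
  have hloc (r : s) := isLocalizedModule_localDet n r.1 (b r)
  have : Module.FinitePresentation R (⋀[R]^n M) :=
    Module.FinitePresentation.of_localizationSpan' s h.span_eq_top
      (Rₚ := fun r : s => Localization.Away r.1)
      (fun r : s => localDet n r.1 (b r)) (fun r => inferInstance)
  refine bijective_of_isLocalized_span s h.span_eq_top
    (fun r : s => Localization.Away r.1) (fun r : s => Algebra.linearMap R (Localization.Away r.1))
    (fun r : s => Localization.Away r.1 →ₗ[Localization.Away r.1] Localization.Away r.1)
    (fun r : s => IsLocalizedModule.mapExtendScalars (Submonoid.powers r.1)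
      (localDet n r.1 (b r)) (localDet n r.1 (b r)) (Localization.Away r.1)) _ fun r => ?_
  let Rr := Localization.Away r.1
  let e := LinearMap.ringLmapEquivSelf Rr Rr Rr
  let G := IsLocalizedModule.map (Submonoid.powers r.1) (Algebra.linearMap R Rr)
    (IsLocalizedModule.mapExtendScalars (Submonoid.powers r.1)
      (localDet n r.1 (b r)) (localDet n r.1 (b r)) Rr)
      (Algebra.linearMap R (Module.End R (⋀[R]^n M)))
  change Function.Bijective G
  have key : (e.toLinearMap.restrictScalars R) ∘ₗ G = LinearMap.id := by
    refine IsLocalizedModule.linearMap_ext (Submonoid.powers r.1) (Algebra.linearMap R Rr)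
      (Algebra.linearMap R Rr) ?_
    ext
    have h1 : G 1 = LinearMap.id := by
      have h2 := IsLocalizedModule.map_apply (Submonoid.powers r.1) (Algebra.linearMap R Rr)
        (IsLocalizedModule.mapExtendScalars (Submonoid.powers r.1)
          (localDet n r.1 (b r)) (localDet n r.1 (b r)) Rr)
        (Algebra.linearMap R (Module.End R (⋀[R]^n M))) 1
      rw [Algebra.linearMap_apply, map_one (algebraMap _ _), Algebra.linearMap_apply,
        map_one (algebraMap _ _)] at h2
      refine h2.trans ?_
      apply LinearMap.restrictScalars_injective R
      refine IsLocalizedModule.linearMap_ext (Submonoid.powers r.1) (localDet n r.1 (b r))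
        (localDet n r.1 (b r)) ?_
      ext x
      simp
    simp [h1, e]
  have key' : (G : Rr → _) = e.symm := by
    funext x
    rw [LinearEquiv.eq_symm_apply]
    exact LinearMap.congr_fun key x
  rw [key']
  exact e.symm.bijective

theorem existsUnique_scalar [IsLocallyFreeOfRank R n M] (T : (⋀[R]^n M) →ₗ[R] (⋀[R]^n M)) :
    ∃! r : R, ∀ v : Fin n → M,
      T (exteriorPower.ιMulti R n v) = r • exteriorPower.ιMulti R n v := by
  obtain ⟨r, hr⟩ := (bijective_algebraMap_end (R := R) (M := M) n).2 T
  refine ⟨r, fun v => by rw [← hr]; simp, fun t ht => ?_⟩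
  apply (bijective_algebraMap_end (R := R) (M := M) n).1
  rw [hr]
  apply exteriorPower.linearMap_ext
  ext v
  simp [ht]

end Wedge

section Norm

variable (R : Type u) [CommRing R] (n : ℕ) {A : Type v} [CommRing A] [Algebra R A]

theorem existsUnique_norm [IsLocallyFreeOfRank R n A] (a : A) :
    ∃! r : R, ∀ v : Fin n → A,
      exteriorPower.ιMulti R n (fun i => a * v i) = r • exteriorPower.ιMulti R n v := by
  obtain ⟨r, hr, hu⟩ := existsUnique_scalar (R := R) n
    (exteriorPower.map n (LinearMap.mulLeft R a))
  refine ⟨r, fun v => ?_, fun t ht => hu t fun v => ?_⟩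
  · rw [← hr, exteriorPower.map_apply_ιMulti]; rfl
  · rw [exteriorPower.map_apply_ιMulti, ← ht]; rfl

/-- The norm of an element `a` of an `R`-algebra `A` of rank `n`: the unique `r : R` with
`(a a₁) ∧ ⋯ ∧ (a aₙ) = r (a₁ ∧ ⋯ ∧ aₙ)` for all `a₁, …, aₙ : A`. -/
noncomputable def rankNorm [IsLocallyFreeOfRank R n A] (a : A) : R :=
  (existsUnique_norm R n a).choose

/-- A homomorphism `f : A → B` of `R`-algebras of rank `n` is norm-preserving if
`N_A(a) = N_B(f a)` for all `a : A`. -/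
def IsNormPreserving (n : ℕ) {R : Type u} [CommRing R] {A : Type v} [CommRing A] [Algebra R A]
    {B : Type w} [CommRing B] [Algebra R B] [IsLocallyFreeOfRank R n A]
    [IsLocallyFreeOfRank R n B] (f : A →ₐ[R] B) : Prop :=
  ∀ a : A, rankNorm R n a = rankNorm R n (f a)

/-- `f : A → B` is universally norm-preserving if `S ⊗ A → S ⊗ B` is norm-preserving as a
homomorphism of `S`-algebras, for every `R`-algebra `S`. -/
def IsUniversallyNormPreserving (n : ℕ) {R : Type u} [CommRing R] {A : Type v} [CommRing A]
    [Algebra R A] {B : Type w} [CommRing B] [Algebra R B] [IsLocallyFreeOfRank R n A]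
    [IsLocallyFreeOfRank R n B] (f : A →ₐ[R] B) : Prop :=
  ∀ (S : Type u) [CommRing S] [Algebra R S],
    IsNormPreserving n (Algebra.TensorProduct.map (AlgHom.id S S) f : S ⊗[R] A →ₐ[S] S ⊗[R] B)

end Norm

section TensorPower

/-- For an `R`-algebra `S` and an `R`-linear map `f : M → N` into an `S`-module, the map
`M ⊗_R ⋯ ⊗_R M → N ⊗_S ⋯ ⊗_S N` induced by `f`. -/
noncomputable def tensorBaseMap {R : Type u} [CommRing R] (n : ℕ) {M : Type v} [AddCommGroup M]
    [Module R M] (S : Type*) [CommRing S] [Algebra R S] {N : Type*} [AddCommGroup N] [Module R N]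
    [Module S N] [IsScalarTower R S N] (f : M →ₗ[R] N) :
    (⨂[R] _ : Fin n, M) →ₗ[R] (⨂[S] _ : Fin n, N) :=
  PiTensorProduct.lift
    (((PiTensorProduct.tprod S).restrictScalars R).compLinearMap fun _ : Fin n => f)

theorem tensorBaseMap_tprod {R : Type u} [CommRing R] (n : ℕ) {M : Type v} [AddCommGroup M]
    [Module R M] (S : Type*) [CommRing S] [Algebra R S] {N : Type*} [AddCommGroup N] [Module R N]
    [Module S N] [IsScalarTower R S N] (f : M →ₗ[R] N) (v : Fin n → M) :
    tensorBaseMap n S f (PiTensorProduct.tprod R v) =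
      PiTensorProduct.tprod S fun i => f (v i) := by
  simp only [tensorBaseMap, PiTensorProduct.lift.tprod]
  rfl

theorem tensorBaseMap_reindex {R : Type u} [CommRing R] (n : ℕ) {M : Type v} [AddCommGroup M]
    [Module R M] (S : Type*) [CommRing S] [Algebra R S] {N : Type*} [AddCommGroup N] [Module R N]
    [Module S N] [IsScalarTower R S N] (f : M →ₗ[R] N) (σ : Equiv.Perm (Fin n))
    (x : ⨂[R] _ : Fin n, M) :
    tensorBaseMap n S f (PiTensorProduct.reindex R (fun _ => M) σ x) =
      PiTensorProduct.reindex S (fun _ => N) σ (tensorBaseMap n S f x) := by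
  have : tensorBaseMap n S f ∘ₗ (PiTensorProduct.reindex R (fun _ => M) σ).toLinearMap =
      ((PiTensorProduct.reindex S (fun _ => N) σ).toLinearMap.restrictScalars R) ∘ₗ
        tensorBaseMap n S f := by
    ext v
    simp only [LinearMap.compMultilinearMap_apply, LinearMap.comp_apply, LinearEquiv.coe_coe,
      LinearMap.restrictScalars_apply, PiTensorProduct.reindex_tprod, tensorBaseMap_tprod]
  exact LinearMap.congr_fun this x

section Fixed

variable (R : Type u) [CommRing R] (n : ℕ) (A : Type v) [CommRing A] [Algebra R A]

/-- The action of a permutation `σ` on `A ⊗ ⋯ ⊗ A`, moving the `i`-th tensor factor to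
position `σ i`. -/
noncomputable def permTensor (σ : Equiv.Perm (Fin n)) :
    (⨂[R] _ : Fin n, A) ≃ₐ[R] (⨂[R] _ : Fin n, A) :=
  AlgEquiv.ofLinearEquiv (PiTensorProduct.reindex R (fun _ : Fin n => A) σ)
    (by
      rw [PiTensorProduct.one_def, PiTensorProduct.reindex_tprod]
      rfl)
    ((LinearMap.map_mul_iff (PiTensorProduct.reindex R (fun _ : Fin n => A) σ).toLinearMap).2 (by
      ext v w
      simp only [LinearMap.compMultilinearMap_apply, LinearMap.compr₂_apply,
        LinearMap.compl₂_apply, LinearMap.comp_apply, LinearMap.mul_apply',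
        LinearEquiv.coe_coe, PiTensorProduct.tprod_mul_tprod, PiTensorProduct.reindex_tprod]
      rfl))

theorem permTensor_tprod (σ : Equiv.Perm (Fin n)) (v : Fin n → A) :
    permTensor R n A σ (PiTensorProduct.tprod R v) =
      PiTensorProduct.tprod R fun i => v (σ.symm i) :=
  PiTensorProduct.reindex_tprod (R := R) (s := fun _ => A) σ v

/-- The subalgebra of `G`-invariants of the `n`-fold tensor power of `A`. -/
noncomputable def fixedPower (G : Subgroup (Equiv.Perm (Fin n))) :
    Subalgebra R (⨂[R] _ : Fin n, A) where
  carrier := {x | ∀ σ ∈ G, permTensor R n A σ x = x}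
  mul_mem' hx hy σ hσ := by rw [map_mul, hx σ hσ, hy σ hσ]
  add_mem' hx hy σ hσ := by rw [map_add, hx σ hσ, hy σ hσ]
  algebraMap_mem' r σ _ := AlgEquiv.commutes _ r

theorem fixedPower_anti {G H : Subgroup (Equiv.Perm (Fin n))} (h : G ≤ H) :
    fixedPower R n A H ≤ fixedPower R n A G :=
  fun _ hx σ hσ => hx σ (h hσ)

/-- The canonical surjection from the tensor power to the exterior power. -/
noncomputable def toWedge : (⨂[R] _ : Fin n, A) →ₗ[R] ⋀[R]^n A :=
  PiTensorProduct.lift (exteriorPower.ιMulti R n (M := A)).toMultilinearMap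

variable {A}

/-- The pure tensor `a ⊗ ⋯ ⊗ a` is symmetric. -/
theorem tprod_const_mem (a : A) :
    PiTensorProduct.tprod R (fun _ : Fin n => a) ∈ fixedPower R n A ⊤ := by
  intro σ _
  exact permTensor_tprod R n A σ _

variable (S : Type w) [CommRing S] [Algebra R S]

theorem tensorBaseMap_mem {B : Type*} [CommRing B] [Algebra R B] [Algebra S B]
    [IsScalarTower R S B] (f : A →ₐ[R] B) (x : fixedPower R n A ⊤) :
    tensorBaseMap n S f.toLinearMap x.1 ∈ fixedPower S n B ⊤ := by
  intro σ hσ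
  refine (tensorBaseMap_reindex n S f.toLinearMap σ x.1).symm.trans ?_
  exact congrArg _ (x.2 σ hσ)

theorem tensorBaseMap_mul {B : Type*} [CommRing B] [Algebra R B] [Algebra S B]
    [IsScalarTower R S B] (f : A →ₐ[R] B) (y z : ⨂[R] _ : Fin n, A) :
    tensorBaseMap n S f.toLinearMap (y * z) =
      tensorBaseMap n S f.toLinearMap y * tensorBaseMap n S f.toLinearMap z := by
  let c := tensorBaseMap n S f.toLinearMap
  have h1 (v w : Fin n → A) : c (PiTensorProduct.tprod R v * PiTensorProduct.tprod R w) =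
      c (PiTensorProduct.tprod R v) * c (PiTensorProduct.tprod R w) := by
    simp only [c, PiTensorProduct.tprod_mul_tprod, tensorBaseMap_tprod]
    congr 1
    funext i
    simp
  have h2 (v : Fin n → A) : c ∘ₗ LinearMap.mulLeft R (PiTensorProduct.tprod R v) =
      ((LinearMap.mulLeft S (c (PiTensorProduct.tprod R v))).restrictScalars R) ∘ₗ c :=
    PiTensorProduct.ext (MultilinearMap.ext fun w => h1 v w)
  have h3 : c ∘ₗ LinearMap.mulRight R z =
      ((LinearMap.mulRight S (c z)).restrictScalars R) ∘ₗ c :=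
    PiTensorProduct.ext (MultilinearMap.ext fun v => LinearMap.congr_fun (h2 v) z)
  exact LinearMap.congr_fun h3 y

end Fixed

theorem lift_eq_zero_of_swap {S : Type*} [CommRing S] {n : ℕ} {B κ : Type*} [AddCommGroup B]
    [Module S B] (b : Module.Basis κ S B) {N : Type*} [AddCommGroup N] [Module S N]
    (g : B [⋀^Fin n]→ₗ[S] N) {i j : Fin n} (hij : i ≠ j) (x : ⨂[S] _ : Fin n, B)
    (hx : PiTensorProduct.reindex S (fun _ => B) (Equiv.swap i j) x = x) :
    PiTensorProduct.lift g.toMultilinearMap x = 0 := by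
  let E := Basis.piTensorProduct fun _ : Fin n => b
  let τ (p : Fin n → κ) : Fin n → κ := p ∘ Equiv.swap i j
  have hE (p : Fin n → κ) :
      PiTensorProduct.reindex S (fun _ => B) (Equiv.swap i j) (E p) = E (τ p) := by
    simp only [E, Basis.piTensorProduct_apply, PiTensorProduct.reindex_tprod]
    rfl
  have hc (p : Fin n → κ) : E.repr x (τ p) = E.repr x p := by
    have h1 : (Finsupp.lapply (R := S) (τ p) ∘ₗ E.repr.toLinearMap) ∘ₗ
        (PiTensorProduct.reindex S (fun _ => B) (Equiv.swap i j)).toLinearMap =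
        Finsupp.lapply (R := S) p ∘ₗ E.repr.toLinearMap := by
      refine E.ext fun q => ?_
      have : τ q = τ p ↔ q = p :=
        (Equiv.swap i j).surjective.injective_comp_right.eq_iff
      classical
      simp [hE, Finsupp.single_apply, this]
    have h2 := LinearMap.congr_fun h1 x
    simpa [hx] using h2
  have hg (p : Fin n → κ) : PiTensorProduct.lift g.toMultilinearMap (E (τ p)) =
      - PiTensorProduct.lift g.toMultilinearMap (E p) := by
    simp only [E, Basis.piTensorProduct_apply, PiTensorProduct.lift.tprod]
    exact g.map_swap (fun k => b (p k)) hij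
  rw [← E.linearCombination_repr x, Finsupp.linearCombination_apply, Finsupp.sum, map_sum]
  refine Finset.sum_involution (fun p _ => τ p) ?_ ?_ ?_ ?_
  · intro p _
    rw [map_smul, map_smul, hc, hg]
    simp
  · intro p _ hp h
    apply hp
    rw [map_smul]
    simp only [E, Basis.piTensorProduct_apply, PiTensorProduct.lift.tprod]
    have : p i = p j := by
      conv_lhs => rw [← h]
      simp [τ]
    have h0 := g.map_eq_zero_of_eq (fun k => b (p k)) (by simp only [this]) hij
    refine (congrArg _ h0).trans (smul_zero _)
  · intro p hp
    simpa [hc] using hp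
  · intro p _
    funext k
    simp [τ]

section Ferrand

variable (R : Type u) [CommRing R] (n : ℕ) (A : Type v) [CommRing A] [Algebra R A]
  [h : IsLocallyFreeOfRank R n A]

theorem toWedge_eq_zero_of_swap {i j : Fin n} (hij : i ≠ j) (x : ⨂[R] _ : Fin n, A)
    (hx : permTensor R n A (Equiv.swap i j) x = x) : toWedge R n A x = 0 := by
  let s := {r : R | Nonempty (Module.Basis (Fin n)
    (Localization.Away r) (LocalizedModule (Submonoid.powers r) A))}
  have (r : s) := isLocalizedModule_localDet n r.1 r.2.some
  refine Module.eq_zero_of_isLocalized_span s h.span_eq_top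
    (fun r : s => Localization.Away r.1) (fun r : s => localDet n r.1 r.2.some) _ fun r => ?_
  let f : A →ₗ[R] LocalizedModule (Submonoid.powers r.1) A := LocalizedModule.mkLinearMap _ _
  have h1 : localDet n r.1 r.2.some ∘ₗ toWedge R n A =
      ((PiTensorProduct.lift r.2.some.det.toMultilinearMap).restrictScalars R) ∘ₗ
        tensorBaseMap n (Localization.Away r.1) f := by
    ext v
    simp [toWedge, tensorBaseMap, localDet_ιMulti]
    rfl
  rw [← LinearMap.comp_apply, h1]
  refine lift_eq_zero_of_swap r.2.some r.2.some.det hij _ ?_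
  rw [← tensorBaseMap_reindex]
  exact congrArg _ hx

variable {A}

/-- Multiplication by a symmetric tensor descends from the tensor power to the exterior power. -/
noncomputable def wedgeAction (x : fixedPower R n A ⊤) : (⋀[R]^n A) →ₗ[R] (⋀[R]^n A) :=
  exteriorPower.alternatingMapLinearEquiv
    { (toWedge R n A ∘ₗ LinearMap.mulLeft R (x : ⨂[R] _ : Fin n, A)).compMultilinearMap
        (PiTensorProduct.tprod R) with
      map_eq_zero_of_eq' := fun v i j hv hij => by
        refine toWedge_eq_zero_of_swap R n A hij _ ?_
        rw [LinearMap.mulLeft_apply, map_mul, x.2 _ (Subgroup.mem_top _)]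
        congr 1
        rw [permTensor_tprod]
        congr 1
        funext k
        rw [Equiv.symm_swap, Equiv.swap_apply_def]
        split_ifs with h1 h2
        · rw [h1, hv]
        · rw [h2, hv]
        · rfl }

theorem wedgeAction_toWedge (x : fixedPower R n A ⊤) (y : ⨂[R] _ : Fin n, A) :
    wedgeAction R n x (toWedge R n A y) = toWedge R n A (x * y) := by
  have : wedgeAction R n x ∘ₗ toWedge R n A =
      toWedge R n A ∘ₗ LinearMap.mulLeft R (x : ⨂[R] _ : Fin n, A) := by
    ext v
    simp [toWedge, wedgeAction]
  exact LinearMap.congr_fun this y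

theorem existsUnique_ferrand (x : fixedPower R n A ⊤) :
    ∃! r : R, ∀ y : ⨂[R] _ : Fin n, A, toWedge R n A (x * y) = r • toWedge R n A y := by
  obtain ⟨r, hr, hu⟩ := existsUnique_scalar (R := R) n (wedgeAction R n x)
  have hr' : wedgeAction R n x = r • LinearMap.id := by
    apply exteriorPower.linearMap_ext
    ext v
    simp [hr]
  refine ⟨r, fun y => ?_, fun t ht => hu t fun v => ?_⟩
  · rw [← wedgeAction_toWedge, hr']; rfl
  · have := ht (PiTensorProduct.tprod R v)
    rw [← wedgeAction_toWedge] at this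
    simpa [toWedge] using this

variable (A)

/-- The Ferrand homomorphism of an `R`-algebra `A` of rank `n`: a symmetric tensor `x` is sent to
the unique scalar by which it acts on the top exterior power of `A`. It sends `a ⊗ ⋯ ⊗ a` to the
norm of `a` (`ferrandHom_diagonal`) and it commutes with base change (`ferrandHom_baseChange`);
so it is the homomorphism that corresponds to the norm as a multiplicative polynomial law of
degree `n`. -/
noncomputable def ferrandHom : fixedPower R n A ⊤ →ₐ[R] R :=
  have spec (x : fixedPower R n A ⊤) := (existsUnique_ferrand R n x).choose_spec.1
  have uniq (x : fixedPower R n A ⊤) (r : R)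
      (hr : ∀ y : ⨂[R] _ : Fin n, A, toWedge R n A (x * y) = r • toWedge R n A y) :
      (existsUnique_ferrand R n x).choose = r :=
    ((existsUnique_ferrand R n x).choose_spec.2 r hr).symm
  { toFun := fun x => (existsUnique_ferrand R n x).choose
    map_one' := uniq _ _ fun y => by simp
    map_mul' := fun x z => uniq _ _ fun y => by
      rw [MulMemClass.coe_mul, mul_assoc, spec x, spec z, smul_smul]
    map_zero' := uniq _ _ fun y => by simp
    map_add' := fun x z => uniq _ _ fun y => by
      rw [AddMemClass.coe_add, add_mul, map_add, spec x, spec z, add_smul]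
    commutes' := fun r => uniq _ _ fun y => by
      rw [Subalgebra.coe_algebraMap, ← Algebra.smul_def, map_smul]; rfl }

variable {A}

theorem ferrandHom_spec (x : fixedPower R n A ⊤) (y : ⨂[R] _ : Fin n, A) :
    toWedge R n A (x * y) = ferrandHom R n A x • toWedge R n A y :=
  (existsUnique_ferrand R n x).choose_spec.1 y

theorem ferrandHom_eq (x : fixedPower R n A ⊤) (r : R)
    (hr : ∀ v : Fin n → A, toWedge R n A (x * PiTensorProduct.tprod R v) =
      r • exteriorPower.ιMulti R n v) : ferrandHom R n A x = r := by
  refine ((existsUnique_ferrand R n x).choose_spec.2 r fun y => ?_).symm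
  have : toWedge R n A ∘ₗ LinearMap.mulLeft R (x : ⨂[R] _ : Fin n, A) = r • toWedge R n A := by
    refine PiTensorProduct.ext (MultilinearMap.ext fun v => ?_)
    refine (hr v).trans ?_
    simp [toWedge]
  exact LinearMap.congr_fun this y

/-- The Ferrand homomorphism sends `a ⊗ ⋯ ⊗ a` to the norm of `a`. -/
theorem ferrandHom_diagonal (a : A) :
    ferrandHom R n A ⟨_, tprod_const_mem R n a⟩ = rankNorm R n a := by
  refine ferrandHom_eq R n _ _ fun v => ?_
  refine Eq.trans ?_ ((existsUnique_norm R n a).choose_spec.1 v)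
  rw [PiTensorProduct.tprod_mul_tprod]
  simp only [toWedge, PiTensorProduct.lift.tprod]
  rfl

section BaseChange

variable (S : Type w) [CommRing S] [Algebra R S]

theorem ferrandHom_tensorBaseMap {B : Type*} [CommRing B] [Algebra R B] [Algebra S B]
    [IsScalarTower R S B] [IsLocallyFreeOfRank S n B] (f : A →ₐ[R] B)
    (hf : Submodule.span S (Set.range f) = ⊤) (x : fixedPower R n A ⊤) :
    ferrandHom S n B ⟨_, tensorBaseMap_mem R n S f x⟩ =
      algebraMap R S (ferrandHom R n A x) := by
  let c := tensorBaseMap n S f.toLinearMap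
  let g : (⋀[R]^n A) →ₗ[R] ⋀[S]^n B := exteriorPower.alternatingMapLinearEquiv
    { ((exteriorPower.ιMulti S n (M := B)).toMultilinearMap.restrictScalars
        R).compLinearMap fun _ : Fin n => f.toLinearMap with
      map_eq_zero_of_eq' := fun _ _ _ hv hij =>
        (exteriorPower.ιMulti S n).map_eq_zero_of_eq _ (congrArg f hv) hij }
  have hg (y : ⨂[R] _ : Fin n, A) : g (toWedge R n A y) = toWedge S n B (c y) := by
    have : g ∘ₗ toWedge R n A = ((toWedge S n B).restrictScalars R) ∘ₗ c := by
      refine PiTensorProduct.ext (MultilinearMap.ext fun v => ?_)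
      simp only [LinearMap.compMultilinearMap_apply, LinearMap.comp_apply,
        LinearMap.restrictScalars_apply, c, tensorBaseMap_tprod, toWedge,
        PiTensorProduct.lift.tprod]
      exact exteriorPower.alternatingMapLinearEquiv_apply_ιMulti _ _
    exact LinearMap.congr_fun this y
  refine ferrandHom_eq S n _ _ fun v => ?_
  let P : MultilinearMap S (fun _ : Fin n => B) (⋀[S]^n B) :=
    (toWedge S n B ∘ₗ LinearMap.mulLeft S (c x.1)).compMultilinearMap
      (PiTensorProduct.tprod S)
  let Q : MultilinearMap S (fun _ : Fin n => B) (⋀[S]^n B) :=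
    algebraMap R S (ferrandHom R n A x) • (exteriorPower.ιMulti S n).toMultilinearMap
  have key : P = Q := by
    refine MultilinearMap.ext_of_span_eq_top (g := fun _ => f) (fun _ => hf) fun a => ?_
    change toWedge S n B (c x.1 * PiTensorProduct.tprod S fun i => f (a i)) =
      algebraMap R S (ferrandHom R n A x) • exteriorPower.ιMulti S n fun i => f (a i)
    have h1 : (PiTensorProduct.tprod S fun i => f (a i)) =
        c (PiTensorProduct.tprod R a) := (tensorBaseMap_tprod n S f.toLinearMap a).symm
    have h2 := hg (x.1 * PiTensorProduct.tprod R a)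
    rw [ferrandHom_spec, map_smul, hg, ← algebraMap_smul S] at h2
    rw [h1, ← tensorBaseMap_mul, ← h2, ← h1]
    simp [toWedge]
  exact congrArg (fun T => T v) key

/-- The Ferrand homomorphisms commute with base change. -/
theorem ferrandHom_baseChange (x : fixedPower R n A ⊤) :
    ferrandHom S n (S ⊗[R] A)
        ⟨_, tensorBaseMap_mem R n S Algebra.TensorProduct.includeRight x⟩ =
      algebraMap R S (ferrandHom R n A x) := by
  refine ferrandHom_tensorBaseMap R n S _ (top_le_iff.1 fun t _ => ?_) x
  induction t with
  | zero => exact zero_mem _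
  | add y z hy hz => exact add_mem (hy trivial) (hz trivial)
  | tmul s a =>
    have : s ⊗ₜ[R] a = s • ((1 : S) ⊗ₜ[R] a) := by simp [TensorProduct.smul_tmul']
    rw [this]
    exact Submodule.smul_mem _ _ (Submodule.subset_span ⟨a, rfl⟩)

end BaseChange

end Ferrand

end TensorPower

section ClosureData

/-- A `G`-closure datum for an `R`-algebra `A` of rank `n`: a homomorphism of `R`-algebras from
the `G`-invariants of the `n`-fold tensor power of `A` to `R` that extends the Ferrand
homomorphism. -/
def IsClosureDatum {R : Type u} [CommRing R] {n : ℕ} {A : Type v} [CommRing A] [Algebra R A]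
    [IsLocallyFreeOfRank R n A] (G : Subgroup (Equiv.Perm (Fin n)))
    (φ : fixedPower R n A G →ₐ[R] R) : Prop :=
  φ.comp (Subalgebra.inclusion (fixedPower_anti R n A le_top)) = ferrandHom R n A

/-- The homomorphism `f₁ ⊗ ⋯ ⊗ fₙ : A ⊗ ⋯ ⊗ A → R` with
`a₁ ⊗ ⋯ ⊗ aₙ ↦ f₁(a₁) ⋯ fₙ(aₙ)`. -/
noncomputable def tensorHom {R : Type u} [CommRing R] {n : ℕ} {A : Type v} [CommRing A]
    [Algebra R A] (f : Fin n → A →ₐ[R] R) : (⨂[R] _ : Fin n, A) →ₐ[R] R :=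
  PiTensorProduct.liftAlgHom
    ((MultilinearMap.mkPiAlgebra R (Fin n) R).compLinearMap fun i => (f i).toLinearMap)
    (by simp) (by simp [Finset.prod_mul_distrib])

end ClosureData

end ClosureDatum

/-!
Write an element of `S ⊗ A` as `x = ∑ sₖ • aₖ` with `aₖ` in `A`. The coefficients of `x ⊗ ⋯ ⊗ x` at
the monomials of degree `n` in the `sₖ` are symmetric tensors with entries `aₖ`, the *monomial
symmetric tensors* (`monomialTensor`). Since the Ferrand homomorphism commutes with base change and
sends `x ⊗ ⋯ ⊗ x` to the norm of `x`, its values at monomial symmetric tensors are the coefficients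
of the norm (`rankNorm_sum_smul`). In the same way, the values of `f₁ ⊗ ⋯ ⊗ fₙ` at monomial symmetric
tensors are the coefficients of `∏ fᵢ(x)` (`prod_sum_smul`), and this product is the norm of the
image of `x` in `S ⊗ Rⁿ` (`rankNorm_tensor_pi`).

If `f₁ ⊗ ⋯ ⊗ fₙ` extends the Ferrand homomorphism, the two expansions agree, hence
`A → Rⁿ` is universally norm-preserving (`rankNorm_eq_prod`).

Conversely, two homomorphisms on the symmetric tensors can be compared after localizations over
which `A` becomes free. Over these the symmetric tensors are spanned by the monomial ones in a basis
(`exists_eq_sum_smul_monomialTensor`), and at a monomial symmetric tensor both homomorphisms are read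
off as coefficients by taking the `sₖ` to be the variables of a polynomial ring
(`ferrandHom_monomialTensor`).
-/

namespace ClosureDatum

/-! ### Monomial symmetric tensors -/

section MonomialTensor

variable (R : Type u) [CommRing R] {n : ℕ} {A : Type v} [CommRing A] [Algebra R A]
  {κ : Type*}

/-- The multiset of values of a tuple `p : Fin n → κ`. Two tuples have the same multiset of values
if and only if they lie in the same orbit of the permutations of `Fin n`. -/
def tupleMultiset (p : Fin n → κ) : Multiset κ :=
  Finset.univ.val.map p

theorem tupleMultiset_comp_perm (p : Fin n → κ) (σ : Equiv.Perm (Fin n)) :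
    tupleMultiset (p ∘ σ) = tupleMultiset p := by
  rw [tupleMultiset, ← Multiset.map_map, Multiset.map_univ_val_equiv σ, tupleMultiset]

theorem exists_perm_of_tupleMultiset_eq [DecidableEq κ] {p q : Fin n → κ}
    (h : tupleMultiset p = tupleMultiset q) : ∃ σ : Equiv.Perm (Fin n), q ∘ σ = p := by
  -- The fibers of `p` and `q` have the same cardinalities: the multiplicities in the multiset.
  have hcard (k : κ) : Fintype.card {i // p i = k} = Fintype.card {i // q i = k} := by
    have := congrArg (Multiset.count k) h
    simp only [tupleMultiset, Multiset.count_map] at this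
    simpa only [Fintype.card_subtype, Finset.card_def, Finset.filter_val, eq_comm] using this
  exact ⟨Equiv.ofFiberEquiv fun k => Fintype.equivOfCardEq (hcard k),
    funext fun i => Equiv.ofFiberEquiv_map _ i⟩

variable [Fintype κ] [DecidableEq κ]

/-- The monomial symmetric tensor of a family `a : κ → A` and a multiset `m` on `κ`: the sum of
`a (p 1) ⊗ ⋯ ⊗ a (p n)` over all tuples `p` with multiset of values `m`. It vanishes unless `m`
has `n` elements. -/
noncomputable def monomialTensor (a : κ → A) (m : Multiset κ) : ⨂[R] _ : Fin n, A :=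
  ∑ p : Fin n → κ with tupleMultiset p = m, PiTensorProduct.tprod R fun i => a (p i)

theorem monomialTensor_mem (a : κ → A) (m : Multiset κ) :
    monomialTensor R (n := n) a m ∈ fixedPower R n A ⊤ := by
  intro σ _
  simp only [monomialTensor, map_sum, permTensor_tprod]
  refine Finset.sum_equiv (σ.symm.arrowCongr (Equiv.refl κ)).symm (fun p => ?_) fun p _ => rfl
  have : (σ.symm.arrowCongr (Equiv.refl κ)).symm p = p ∘ σ.symm := rfl
  rw [this, Finset.mem_filter_univ, Finset.mem_filter_univ, tupleMultiset_comp_perm]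

/-- Grouping the tuples in `Fin n → κ` by their multisets of values. -/
theorem sum_eq_sum_tupleMultiset {M : Type*} [AddCommMonoid M] (F : (Fin n → κ) → M) :
    ∑ p, F p = ∑ m ∈ Finset.univ.image (tupleMultiset (n := n) (κ := κ)),
      ∑ p with tupleMultiset p = m, F p :=
  (Finset.sum_fiberwise_of_maps_to (fun p _ => Finset.mem_image_of_mem _ (Finset.mem_univ p))
    F).symm

/-- If `A` is free, then the symmetric tensors are the linear combinations of the monomial
symmetric tensors of a basis. -/
theorem exists_eq_sum_smul_monomialTensor (b : Module.Basis κ R A) (x : fixedPower R n A ⊤) :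
    ∃ c : Multiset κ → R, (x : ⨂[R] _ : Fin n, A) =
      ∑ m ∈ Finset.univ.image (tupleMultiset (n := n) (κ := κ)),
        c m • monomialTensor R b m := by
  let E := Basis.piTensorProduct fun _ : Fin n => b
  -- The coordinates of a symmetric tensor are constant on orbits of permutations.
  have hc (σ : Equiv.Perm (Fin n)) (p : Fin n → κ) :
      E.repr x.1 (p ∘ σ) = E.repr x.1 p := by
    have h1 : (Finsupp.lapply (R := R) p ∘ₗ E.repr.toLinearMap) ∘ₗ
        (permTensor R n A σ).toLinearMap =
        Finsupp.lapply (R := R) (p ∘ σ) ∘ₗ E.repr.toLinearMap := by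
      refine E.ext fun q => ?_
      have hE : permTensor R n A σ (E q) = E (q ∘ σ.symm) := by
        simp only [E, Basis.piTensorProduct_apply, permTensor_tprod]
        rfl
      have : q ∘ σ.symm = p ↔ q = p ∘ σ := by
        rw [Equiv.comp_symm_eq]
      simp [hE, Finsupp.single_apply, this]
    have h2 := LinearMap.congr_fun h1 x.1
    simpa [x.2 σ (Subgroup.mem_top _)] using h2.symm
  have hfac (p q : Fin n → κ) (h : tupleMultiset p = tupleMultiset q) :
      E.repr x.1 p = E.repr x.1 q := by
    obtain ⟨σ, rfl⟩ := exists_perm_of_tupleMultiset_eq h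
    exact hc σ q
  refine ⟨fun m => if h : ∃ p : Fin n → κ, tupleMultiset p = m then E.repr x.1 h.choose else 0, ?_⟩
  conv_lhs => rw [← E.sum_repr x.1, sum_eq_sum_tupleMultiset]
  refine Finset.sum_congr rfl fun m _ => ?_
  rw [monomialTensor, Finset.smul_sum]
  refine Finset.sum_congr rfl fun p hp => ?_
  have h : ∃ p : Fin n → κ, tupleMultiset p = m := ⟨p, (Finset.mem_filter.1 hp).2⟩
  beta_reduce
  rw [dif_pos h, hfac p h.choose ((Finset.mem_filter.1 hp).2.trans h.choose_spec.symm),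
    Basis.piTensorProduct_apply]

end MonomialTensor

/-! ### Expansion of the norm of a linear combination -/

section Expansion

variable (R : Type u) [CommRing R] (n : ℕ) {A : Type v} [CommRing A] [Algebra R A]
  {κ : Type*} [Fintype κ] [DecidableEq κ]
  {S : Type w} [CommRing S] [Algebra R S]
  {B : Type*} [CommRing B] [Algebra R B] [Algebra S B] [IsScalarTower R S B]

/-- The monomial symmetric tensors are the coefficients of the `n`-th tensor power of a linear
combination. -/
theorem tprod_sum_smul (g : A →ₐ[R] B) (a : κ → A) (s : κ → S) :
    PiTensorProduct.tprod S (fun _ : Fin n => ∑ k, s k • g (a k)) =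
      ∑ m ∈ Finset.univ.image (tupleMultiset (n := n) (κ := κ)),
        (m.map s).prod • tensorBaseMap n S g.toLinearMap (monomialTensor R a m) := by
  rw [MultilinearMap.map_sum, sum_eq_sum_tupleMultiset]
  refine Finset.sum_congr rfl fun m _ => ?_
  rw [monomialTensor, map_sum, Finset.smul_sum]
  refine Finset.sum_congr rfl fun p hp => ?_
  rw [MultilinearMap.map_smul_univ, tensorBaseMap_tprod, ← (Finset.mem_filter.1 hp).2,
    tupleMultiset, Multiset.map_map]
  rfl

/-- The norm of a linear combination of elements of `A`, after base change, has the values of the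
Ferrand homomorphism at monomial symmetric tensors as coefficients. -/
theorem rankNorm_sum_smul [IsLocallyFreeOfRank R n A] [IsLocallyFreeOfRank S n B]
    (g : A →ₐ[R] B) (hg : Submodule.span S (Set.range g) = ⊤) (a : κ → A) (s : κ → S) :
    rankNorm S n (∑ k, s k • g (a k)) =
      ∑ m ∈ Finset.univ.image (tupleMultiset (n := n) (κ := κ)),
        (m.map s).prod *
          algebraMap R S (ferrandHom R n A ⟨_, monomialTensor_mem R a m⟩) := by
  rw [← ferrandHom_diagonal]
  have : (⟨_, tprod_const_mem S n (∑ k, s k • g (a k))⟩ : fixedPower S n B ⊤) =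
      ∑ m ∈ Finset.univ.image (tupleMultiset (n := n) (κ := κ)),
        (m.map s).prod • (⟨_, tensorBaseMap_mem R n S g ⟨_, monomialTensor_mem R a m⟩⟩ :
          fixedPower S n B ⊤) := by
    apply Subtype.ext
    rw [AddSubmonoidClass.coe_finsetSum]
    exact tprod_sum_smul R n g a s
  rw [this, map_sum]
  refine Finset.sum_congr rfl fun m _ => ?_
  rw [map_smul, smul_eq_mul]
  congr 1
  exact ferrandHom_tensorBaseMap R n S g hg ⟨_, monomialTensor_mem R a m⟩

variable {R n} in
theorem tensorHom_tprod (f : Fin n → A →ₐ[R] R) (v : Fin n → A) :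
    tensorHom f (PiTensorProduct.tprod R v) = ∏ i, f i (v i) := by
  refine (PiTensorProduct.lift.tprod v).trans ?_
  simp

variable {R n} in
theorem tensorHom_tensorBaseMap (g : A →ₐ[R] B) (f : Fin n → A →ₐ[R] R)
    (F : Fin n → B →ₐ[S] S) (hF : ∀ i a, F i (g a) = algebraMap R S (f i a))
    (x : ⨂[R] _ : Fin n, A) :
    tensorHom F (tensorBaseMap n S g.toLinearMap x) = algebraMap R S (tensorHom f x) := by
  have : (tensorHom F).toLinearMap.restrictScalars R ∘ₗ tensorBaseMap n S g.toLinearMap =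
      Algebra.linearMap R S ∘ₗ (tensorHom f).toLinearMap := by
    refine PiTensorProduct.ext (MultilinearMap.ext fun v => ?_)
    simp [tensorBaseMap_tprod, tensorHom_tprod, hF, map_prod]
  exact LinearMap.congr_fun this x

theorem prod_sum_smul (g : A →ₐ[R] B) (f : Fin n → A →ₐ[R] R)
    (F : Fin n → B →ₐ[S] S) (hF : ∀ i a, F i (g a) = algebraMap R S (f i a))
    (a : κ → A) (s : κ → S) :
    ∏ i, F i (∑ k, s k • g (a k)) =
      ∑ m ∈ Finset.univ.image (tupleMultiset (n := n) (κ := κ)),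
        (m.map s).prod * algebraMap R S (tensorHom f (monomialTensor R a m)) := by
  rw [← tensorHom_tprod F fun _ => ∑ k, s k • g (a k), tprod_sum_smul, map_sum]
  simp only [map_smul, tensorHom_tensorBaseMap g f F hF, smul_eq_mul]

end Expansion

/-! ### Norms on base changes of `Rⁿ` -/

section BaseChange

variable {R : Type u} [CommRing R] {A : Type v} [CommRing A] [Algebra R A]
  (S : Type w) [CommRing S] [Algebra R S]

/-- The base change to `S` of a homomorphism of algebras `A → R`, with values in `S` in place of
`S ⊗ R`. -/
noncomputable def baseChangeHom (h : A →ₐ[R] R) : S ⊗[R] A →ₐ[S] S :=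
  Algebra.TensorProduct.lift (Algebra.ofId S S) ((Algebra.ofId R S).comp h)
    fun _ _ => Commute.all _ _

@[simp]
theorem baseChangeHom_tmul (h : A →ₐ[R] R) (s : S) (a : A) :
    baseChangeHom S h (s ⊗ₜ a) = s * algebraMap R S (h a) := by
  simp [baseChangeHom, Algebra.ofId_apply]

/-- The norm of an element of `S ⊗ Rⁿ` is the product of its coordinates. -/
theorem rankNorm_tensor_pi (n : ℕ) (y : S ⊗[R] (Fin n → R)) :
    rankNorm S n y = ∏ i, baseChangeHom S (Pi.evalAlgHom R (fun _ => R) i) y := by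
  let e : Module.Basis (Fin n) S (S ⊗[R] (Fin n → R)) := (Pi.basisFun R (Fin n)).baseChange S
  have he (i : Fin n) : y * e i = baseChangeHom S (Pi.evalAlgHom R (fun _ => R) i) y • e i := by
    induction y with
    | zero => simp
    | add y z hy hz => rw [add_mul, hy, hz, map_add, add_smul]
    | tmul s v =>
      have hv : v * Pi.single i 1 = v i • (Pi.single i 1 : Fin n → R) := by
        funext j
        by_cases h : j = i
        · subst h; simp
        · simp [h]
      have he' : e i = 1 ⊗ₜ Pi.single i 1 := by simp [e]
      rw [he', Algebra.TensorProduct.tmul_mul_tmul, hv, baseChangeHom_tmul, mul_one,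
        TensorProduct.tmul_smul, TensorProduct.smul_tmul', TensorProduct.smul_tmul', smul_eq_mul,
        mul_one, Algebra.smul_def, mul_comm]
      rfl
  -- Multiplication by `y` is diagonal in the basis `e`; evaluate the determinant on `e`.
  have h1 := (existsUnique_norm S n y).choose_spec.1 e
  simp only [he] at h1
  rw [AlternatingMap.map_smul_univ] at h1
  have h2 := congrArg (exteriorPower.alternatingMapLinearEquiv e.det) h1
  simpa [rankNorm, e.det_self] using h2.symm

theorem baseChangeHom_map_pi {n : ℕ} (f : Fin n → A →ₐ[R] R) (i : Fin n) (x : S ⊗[R] A) :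
    baseChangeHom S (Pi.evalAlgHom R (fun _ => R) i)
      (Algebra.TensorProduct.map (AlgHom.id S S) (AlgHom.pi f) x) = baseChangeHom S (f i) x := by
  induction x with
  | zero => simp
  | add x y hx hy => rw [map_add, map_add, map_add, hx, hy]
  | tmul s a => simp

/-- `f₁, …, fₙ : A → R` define a universally norm-preserving homomorphism `A → Rⁿ` if and only if
the norm becomes the product of the `fᵢ` over every base. -/
theorem isUniversallyNormPreserving_pi_iff {n : ℕ} [IsLocallyFreeOfRank R n A]
    (f : Fin n → A →ₐ[R] R) :
    IsUniversallyNormPreserving n (AlgHom.pi f) ↔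
      ∀ (S : Type u) [CommRing S] [Algebra R S] (x : S ⊗[R] A),
        rankNorm S n x = ∏ i, baseChangeHom S (f i) x := by
  simp only [IsUniversallyNormPreserving, IsNormPreserving, rankNorm_tensor_pi,
    baseChangeHom_map_pi]

theorem span_range_includeRight :
    Submodule.span S (Set.range (Algebra.TensorProduct.includeRight : A →ₐ[R] S ⊗[R] A)) = ⊤ := by
  refine top_le_iff.1 fun t _ => ?_
  induction t with
  | zero => exact zero_mem _
  | add y z hy hz => exact add_mem (hy trivial) (hz trivial)
  | tmul s a =>
    have : s ⊗ₜ[R] a = s • ((1 : S) ⊗ₜ[R] a) := by simp [TensorProduct.smul_tmul']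
    rw [this]
    exact Submodule.smul_mem _ _ (Submodule.subset_span ⟨a, rfl⟩)

end BaseChange

/-! ### Monomials indexed by multisets -/

theorem prod_map_X {κ : Type*} [DecidableEq κ] (S : Type u) [CommRing S] (m : Multiset κ) :
    (m.map (MvPolynomial.X : κ → MvPolynomial κ S)).prod =
      MvPolynomial.monomial (Multiset.toFinsupp m) 1 := by
  induction m using Multiset.induction_on with
  | empty => simp
  | cons k m ih =>
    rw [Multiset.map_cons, Multiset.prod_cons, ih, ← Multiset.singleton_add, map_add,
      Multiset.toFinsupp_singleton, MvPolynomial.X, MvPolynomial.monomial_mul, one_mul]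

/-- Distinct multisets give distinct monomials, so that coefficients can be compared. -/
theorem eq_of_sum_prod_map_X_mul_C_eq {κ : Type*} [DecidableEq κ] {S : Type u} [CommRing S]
    {s : Finset (Multiset κ)} {c d : Multiset κ → S}
    (h : ∑ m ∈ s, (m.map (MvPolynomial.X : κ → MvPolynomial κ S)).prod * MvPolynomial.C (c m) =
      ∑ m ∈ s, (m.map (MvPolynomial.X : κ → MvPolynomial κ S)).prod * MvPolynomial.C (d m))
    {m : Multiset κ} (hm : m ∈ s) : c m = d m := by
  have hcoeff (m' : Multiset κ) (r : S) : MvPolynomial.coeff (Multiset.toFinsupp m)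
      ((m'.map (MvPolynomial.X : κ → MvPolynomial κ S)).prod * MvPolynomial.C r) =
        if m' = m then r else 0 := by
    rw [prod_map_X, mul_comm, MvPolynomial.C_mul_monomial, mul_one, MvPolynomial.coeff_monomial]
    simp only [EmbeddingLike.apply_eq_iff_eq]
  have := congrArg (MvPolynomial.coeff (Multiset.toFinsupp m)) h
  simpa only [MvPolynomial.coeff_sum, hcoeff, Finset.sum_ite_eq', if_pos hm] using this

/-! ### Comparison of the Ferrand homomorphism with the tensor product of homomorphisms -/

section Comparison

variable {R : Type u} [CommRing R] {n : ℕ} {A : Type v} [CommRing A] [Algebra R A]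
  [IsLocallyFreeOfRank R n A]

/-- If the norm is the product of the `fᵢ` over every base, then, over every base `S`, the Ferrand
homomorphism agrees with `f₁ ⊗ ⋯ ⊗ fₙ` on monomial symmetric tensors: these are coefficients of
the norm, and of the product, of a generic linear combination with coefficients in a polynomial
ring over `S`. -/
theorem ferrandHom_monomialTensor (f : Fin n → A →ₐ[R] R)
    (hf : ∀ (S : Type u) [CommRing S] [Algebra R S] (x : S ⊗[R] A),
      rankNorm S n x = ∏ i, baseChangeHom S (f i) x)
    (S : Type u) [CommRing S] [Algebra R S] {κ : Type} [Fintype κ] [DecidableEq κ]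
    (a : κ → S ⊗[R] A) {m : Multiset κ}
    (hm : m ∈ Finset.univ.image (tupleMultiset (n := n) (κ := κ))) :
    ferrandHom S n (S ⊗[R] A) ⟨_, monomialTensor_mem S a m⟩ =
      tensorHom (fun i => baseChangeHom S (f i)) (monomialTensor S a m) := by
  let P := MvPolynomial κ S
  let g : S ⊗[R] A →ₐ[S] P ⊗[R] A :=
    Algebra.TensorProduct.map (Algebra.ofId S P) (AlgHom.id R A)
  -- The range of `g` contains the image of `A`.
  have hg : Submodule.span P (Set.range g) = ⊤ := by
    refine top_le_iff.1 ((span_range_includeRight (R := R) (A := A) P).ge.trans ?_)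
    refine Submodule.span_mono ?_
    rintro _ ⟨x, rfl⟩
    exact ⟨1 ⊗ₜ x, by simp [g]⟩
  have hF (i : Fin n) (x : S ⊗[R] A) :
      baseChangeHom P (f i) (g x) = algebraMap S P (baseChangeHom S (f i) x) := by
    induction x with
    | zero => simp
    | add x y hx hy => simp only [map_add, hx, hy]
    | tmul s a =>
      simp [g, Algebra.ofId_apply, IsScalarTower.algebraMap_apply R S P]
  have key := hf P (∑ k, (MvPolynomial.X k : P) • g (a k))
  rw [rankNorm_sum_smul S n g hg,
    prod_sum_smul S n g (fun i => baseChangeHom S (f i)) _ hF] at key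
  exact eq_of_sum_prod_map_X_mul_C_eq
    (c := fun m => ferrandHom S n (S ⊗[R] A) ⟨_, monomialTensor_mem S a m⟩) key hm

/-- If `f₁ ⊗ ⋯ ⊗ fₙ` extends the Ferrand homomorphism, then the norm is the product of the `fᵢ`
over every base. -/
theorem rankNorm_eq_prod (f : Fin n → A →ₐ[R] R)
    (hf : ∀ x : fixedPower R n A ⊤, tensorHom f x = ferrandHom R n A x)
    (S : Type w) [CommRing S] [Algebra R S] (x : S ⊗[R] A) :
    rankNorm S n x = ∏ i, baseChangeHom S (f i) x := by
  classical
  obtain ⟨T, rfl⟩ := TensorProduct.exists_finset x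
  have hT : ∑ i ∈ T, i.1 ⊗ₜ[R] i.2 = ∑ k : T, k.1.1 •
      (Algebra.TensorProduct.includeRight : A →ₐ[R] S ⊗[R] A) k.1.2 := by
    rw [← Finset.sum_coe_sort]
    simp [TensorProduct.smul_tmul']
  rw [hT, rankNorm_sum_smul R n _ (span_range_includeRight S) (fun k : T => k.1.2),
    prod_sum_smul R n _ f _ (fun i a => by simp) (fun k : T => k.1.2)]
  simp only [← hf]

/-- If the norm is the product of the `fᵢ` over every base, then `f₁ ⊗ ⋯ ⊗ fₙ` extends the Ferrand
homomorphism. -/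
theorem tensorHom_eq_ferrandHom (f : Fin n → A →ₐ[R] R)
    (hf : ∀ (S : Type u) [CommRing S] [Algebra R S] (x : S ⊗[R] A),
      rankNorm S n x = ∏ i, baseChangeHom S (f i) x)
    (x : fixedPower R n A ⊤) : tensorHom f x = ferrandHom R n A x := by
  let s := {r : R | Nonempty (Module.Basis (Fin n)
    (Localization.Away r) (LocalizedModule (Submonoid.powers r) A))}
  refine Module.eq_of_isLocalized_span s (IsLocallyFreeOfRank.span_eq_top (M := A))
    (fun r : s => Localization.Away r.1)
    (fun r : s => Algebra.linearMap R (Localization.Away r.1)) _ _ fun r => ?_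
  let S := Localization.Away r.1
  let b : Module.Basis (Fin n) S (S ⊗[R] A) :=
    r.2.some.map (IsLocalizedModule.isBaseChange (Submonoid.powers r.1) S
      (LocalizedModule.mkLinearMap (Submonoid.powers r.1) A)).equiv.symm
  let y : fixedPower S n (S ⊗[R] A) ⊤ :=
    ⟨_, tensorBaseMap_mem R n S Algebra.TensorProduct.includeRight x⟩
  change algebraMap R S (tensorHom f x) = algebraMap R S (ferrandHom R n A x)
  rw [← ferrandHom_baseChange, ← tensorHom_tensorBaseMap
    (Algebra.TensorProduct.includeRight : A →ₐ[R] S ⊗[R] A) f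
    (fun i => baseChangeHom S (f i)) (fun i a => by simp)]
  change tensorHom _ y.1 = ferrandHom S n (S ⊗[R] A) y
  obtain ⟨c, hc⟩ := exists_eq_sum_smul_monomialTensor S b y
  have hy : y = ∑ m ∈ Finset.univ.image (tupleMultiset (n := n)),
      c m • (⟨_, monomialTensor_mem S b m⟩ : fixedPower S n (S ⊗[R] A) ⊤) := by
    apply Subtype.ext
    rw [AddSubmonoidClass.coe_finsetSum]
    exact hc
  rw [hc]
  conv_rhs => rw [hy]
  rw [map_sum, map_sum]
  refine Finset.sum_congr rfl fun m hm => ?_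
  rw [map_smul, map_smul, ferrandHom_monomialTensor f hf S b hm]

end Comparison

end ClosureDatum

theorem mainTheorem12 {R : Type u} [CommRing R] {n : ℕ} {A : Type v} [CommRing A] [Algebra R A]
    [ClosureDatum.IsLocallyFreeOfRank R n A] (f : Fin n → A →ₐ[R] R) :
    ClosureDatum.IsClosureDatum (⊥ : Subgroup (Equiv.Perm (Fin n)))
        ((ClosureDatum.tensorHom f).comp (ClosureDatum.fixedPower R n A ⊥).val) ↔
      ClosureDatum.IsUniversallyNormPreserving n (AlgHom.pi f) := by
  rw [ClosureDatum.isUniversallyNormPreserving_pi_iff]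
  constructor
  · intro h S _ _ x
    exact ClosureDatum.rankNorm_eq_prod f (fun x => DFunLike.congr_fun h x) S x
  · intro h
    exact AlgHom.ext fun x => ClosureDatum.tensorHom_eq_ferrandHom f h x
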